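/- Fix a constant $C\in(1,1.5]$. There is a constant $\kappa=\kappa(C)>0$, depending only on $C$, such that the following holds for all integers $n\ge 1$, $b\ge 0$ and every probability vector $p=(p_1,\dots,p_n)$ with $$p_n\ge \frac{C}{n}\qquad\text{and}\qquad b\ge \frac{384}{(C-1)^2}\,n\log n$$ ($\log$ is the natural logarithm). Consider the unweighted batched allocation process with batch size $b$, probability vector $p$ and random tie-breaking. Its state is the normalized load vector $y^t\in\mathbb R^n$ (load minus average load $t/n$), sorted so that $y^t_1\ge\dots\ge y^t_n$, with $y^0=0$. For $t=0,b,2b,\dots$, given $y^t$, put $$\tilde p_i:=\frac{1}{|\{j: y^t_j=y^t_i\}|}\sum_{j:\,y^t_j=y^t_i}p_j\qquad(1\le i\le n),$$ sample $i_1,\dots,i_b$ independently from $\tilde p$, put $z_i:=y^t_i+|\{j\in\{1,\dots,b\}: i_j=i\}|-\frac bn$, and let $y^{t+b}$ be $z$ sorted in non-increasing order. Let $\mathrm{Gap}(t):=y^t_1$, i.e. the maximum load minus $t/n$. Then $$\Pr\Big[\mathrm{Gap}(2b)\ge \frac{C-1}{8}\cdot\frac bn\Big]\ge\kappa .$$ 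-/

import Mathlib

open scoped ENNReal

namespace BatchedBins

noncomputable section

/-- The `b`-fold product of a distribution `q` on `n` bins: `b` independent samples from `q`. -/
def iidSamples {n : ℕ} (b : ℕ) (q : PMF (Fin n)) : PMF (Fin b → Fin n) :=
  PMF.ofFintype (fun s => ∏ j, q (s j)) (by
    have hq : ∑ i, q i = 1 := by simpa [tsum_fintype] using q.tsum_coe
    have h := Finset.prod_univ_sum (fun _ : Fin b => (Finset.univ : Finset (Fin n)))
      (fun _ i => q i)
    rw [Fintype.piFinset_univ] at h
    rw [← h]
    simp [hq])

/-- The positions whose entry in `y` equals the entry of position `i`. -/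
def tieClass {n : ℕ} (y : Fin n → ℝ) (i : Fin n) : Finset (Fin n) :=
  Finset.univ.filter (fun j => y j = y i)

/-- Random tie-breaking: the probability of position `i` is the average of the
probabilities `p j` over all positions `j` with the same load as `i`. -/
def tieBreak {n : ℕ} (p : PMF (Fin n)) (y : Fin n → ℝ) : PMF (Fin n) :=
  PMF.ofFintype (fun i => ((tieClass y i).card : ℝ≥0∞)⁻¹ * ∑ j ∈ tieClass y i, p j) (by
    have hp : ∑ i, p i = 1 := by simpa [tsum_fintype] using p.tsum_coe
    rw [← hp]
    simp only [Finset.mul_sum]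
    rw [Finset.sum_comm' (t' := Finset.univ) (s' := fun j => tieClass y j)
      (by intro i j; simp [tieClass, eq_comm])]
    refine Finset.sum_congr rfl fun j _ => ?_
    have hc : ∀ i ∈ tieClass y j,
        ((tieClass y i).card : ℝ≥0∞)⁻¹ * p j = ((tieClass y j).card : ℝ≥0∞)⁻¹ * p j := by
      intro i hi
      have h : y i = y j := by simpa [tieClass] using hi
      simp [tieClass, h]
    rw [Finset.sum_congr rfl hc, Finset.sum_const, nsmul_eq_mul, ← mul_assoc,
      ENNReal.mul_inv_cancel, one_mul]
    · have : j ∈ tieClass y j := by simp [tieClass]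
      simpa using Finset.ne_empty_of_mem this
    · exact ENNReal.natCast_ne_top _)

/-- The entries of `z` rearranged in non-increasing order. -/
def sortDesc {n : ℕ} (z : Fin n → ℝ) : Fin n → ℝ :=
  z ∘ Tuple.sort (fun i => -z i)

theorem sortDesc_antitone {n : ℕ} (z : Fin n → ℝ) : Antitone (sortDesc z) := fun _ _ h =>
  neg_le_neg_iff.mp (Tuple.monotone_sort (fun i => -z i) h)

/-- The sorted normalized load vector after a batch with allocations `s`, where every ball
has weight one and `y` is the sorted normalized load vector before the batch. -/
def batchUpdate {n b : ℕ} (y : Fin n → ℝ) (s : Fin b → Fin n) : Fin n → ℝ :=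
  sortDesc (fun i => y i + ((Finset.univ.filter (fun j => s j = i)).card : ℝ) - (b : ℝ) / n)

/-- The law of the sorted normalized load vector after `k` batches of `b` balls each
(that is, at time `k * b`), for the unweighted batched allocation process with
probability vector `p` and random tie-breaking, started from empty bins. -/
def loadLaw {n : ℕ} (b : ℕ) (p : PMF (Fin n)) : ℕ → PMF (Fin n → ℝ)
  | 0 => PMF.pure 0
  | k + 1 => (loadLaw b p k).bind fun y =>
      (iidSamples b (tieBreak p y)).map fun s => batchUpdate y s

/-- The gap: the maximum load minus the average load, i.e. the largest normalized load. -/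
def gap {n : ℕ} (y : Fin n → ℝ) : ℝ := ⨆ i, y i

end

end BatchedBins

namespace BatchedBins

/-! From empty bins all positions are tied, so the first batch is uniform. Chernoff
(`sum_prod_le_exp`) keeps every load above `(1 - δ) * (b / n)` with `δ = (C - 1) / 4`, and switching
(`card_not_uniqueMin_mul_le`) makes the least loaded bin unique with constant probability; together
these have probability at least `1 / 4` (`card_uniqueMin_ge`). The last position is then tied with
no other, so it keeps its own probability, at least `C / n`. With probability at least `1 / 2` the
second batch gives it more than `(1 - δ) * C * (b / n)` balls, which outweighs its deficit `δ * (b /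
n)`. Hence `κ = 1 / 8` works, for every `C`. -/

/-! ### Lower tail of occupancy counts -/

/-- The number of samples in `s` that are equal to `i`. -/
def occ {n b : ℕ} (s : Fin b → Fin n) (i : Fin n) : ℕ :=
  (Finset.univ.filter (fun j => s j = i)).card

/-- Lower-tail Chernoff bound for the number of samples that are equal to `i`. -/
theorem sum_prod_le_exp {n b : ℕ} (w : Fin n → ℝ) (hw : ∀ i, 0 ≤ w i) (hs : ∑ i, w i = 1)
    (i : Fin n) {μ δ : ℝ} (hδ₀ : 0 ≤ δ) (hδ₁ : δ ≤ 1) (hμ : μ ≤ b * w i) :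
    ∑ s : Fin b → Fin n with (occ s i : ℝ) ≤ (1 - δ) * μ, ∏ j, w (s j)
      ≤ Real.exp (-(δ ^ 2 * μ / 4)) := by
  -- The bound on `E exp(-l * occ)` leaves the exponent `μ * (l ^ 2 - l * δ)`, minimized at `δ / 2`.
  set l : ℝ := δ / 2 with hl
  let f : Fin n → ℝ := fun k => w k * if k = i then Real.exp (-l) else 1
  have hf : ∀ k, 0 ≤ f k := fun k => mul_nonneg (hw k) (by split_ifs <;> positivity)
  have hprod (s : Fin b → Fin n) :
      ∏ j, f (s j) = (∏ j, w (s j)) * Real.exp (-(l * occ s i)) := by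
    rw [Finset.prod_mul_distrib, Finset.prod_ite]
    simp only [Finset.prod_const, one_pow, mul_one, occ, ← Real.exp_nat_mul]
    ring_nf
  have hsum : ∑ k, f k = 1 - w i * (1 - Real.exp (-l)) := by
    have h (k : Fin n) : f k = w k - if k = i then w k * (1 - Real.exp (-l)) else 0 := by
      simp only [f]; split_ifs <;> ring
    simp [h, Finset.sum_sub_distrib, hs]
  have hexp : l - l ^ 2 ≤ 1 - Real.exp (-l) := by
    have h := (abs_le.mp (Real.abs_exp_sub_one_sub_id_le (x := -l)
      (by rw [abs_neg, abs_of_nonneg] <;> linarith))).2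
    nlinarith
  calc ∑ s : Fin b → Fin n with (occ s i : ℝ) ≤ (1 - δ) * μ, ∏ j, w (s j)
      ≤ ∑ s : Fin b → Fin n with (occ s i : ℝ) ≤ (1 - δ) * μ,
          Real.exp (l * ((1 - δ) * μ)) * ∏ j, f (s j) := by
        refine Finset.sum_le_sum fun s h => ?_
        rw [hprod, mul_left_comm, ← Real.exp_add]
        refine le_mul_of_one_le_right (Finset.prod_nonneg fun j _ => hw _) (Real.one_le_exp ?_)
        have := mul_le_mul_of_nonneg_left (Finset.mem_filter.mp h).2 (by linarith : 0 ≤ l)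
        linarith
    _ ≤ ∑ s : Fin b → Fin n, Real.exp (l * ((1 - δ) * μ)) * ∏ j, f (s j) :=
        Finset.sum_le_sum_of_subset_of_nonneg (Finset.filter_subset _ _) fun s _ _ =>
          mul_nonneg (Real.exp_nonneg _) (Finset.prod_nonneg fun j _ => hf _)
    _ = Real.exp (l * ((1 - δ) * μ)) * (∑ k, f k) ^ b := by
        rw [← Finset.mul_sum, Fintype.sum_pow]
    _ ≤ Real.exp (l * ((1 - δ) * μ)) * Real.exp (-(w i * (1 - Real.exp (-l)))) ^ b := by
        have h0 : 0 ≤ ∑ k, f k := Finset.sum_nonneg fun k _ => hf k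
        gcongr
        rw [hsum]
        exact Real.one_sub_le_exp_neg _
    _ = Real.exp (l * ((1 - δ) * μ) - b * w i * (1 - Real.exp (-l))) := by
        rw [← Real.exp_nat_mul, ← Real.exp_add]; ring_nf
    _ ≤ Real.exp (-(δ ^ 2 * μ / 4)) := by
        refine Real.exp_le_exp.mpr ?_
        have h0 : 0 ≤ (b : ℝ) * w i := mul_nonneg b.cast_nonneg (hw i)
        have h1 := mul_le_mul_of_nonneg_left hexp h0
        have h2 := mul_le_mul_of_nonneg_right hμ (by nlinarith : 0 ≤ l - l ^ 2)
        rw [hl] at *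
        nlinarith

/-! ### Unique minimum by switching -/

/-- `s` has a least loaded bin that is strictly below all the others. -/
def UniqueMin {n b : ℕ} (s : Fin b → Fin n) : Prop :=
  ∃ i, ∀ k, k ≠ i → occ s i < occ s k

/-- The additive form avoids truncated subtraction and also covers `c = s j`. -/
theorem occ_update {n b : ℕ} (s : Fin b → Fin n) (j : Fin b) (c : Fin n)
      (k : Fin n) : occ (Function.update s j c) k + (if k = s j then 1 else 0)
      = occ s k + if k = c then 1 else 0 := by
  have key (t : Fin b → Fin n) :
      occ t k = (∑ x ∈ Finset.univ.erase j, if t x = k then 1 else 0) + if t j = k then 1 else 0 := by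
    rw [Finset.sum_erase_add _ _ (Finset.mem_univ j), occ, Finset.card_filter]
  have h : (∑ x ∈ Finset.univ.erase j, if Function.update s j c x = k then 1 else 0)
      = ∑ x ∈ Finset.univ.erase j, if s x = k then 1 else 0 :=
    Finset.sum_congr rfl fun x hx => by
      rw [Function.update_of_ne (Finset.ne_of_mem_erase hx)]
  rw [key s, key (Function.update s j c), h, Function.update_self]
  simp only [eq_comm (a := k)]
  omega

theorem occ_update_lt {n b : ℕ} {s : Fin b → Fin n} {j : Fin b} {c : Fin n} (hc : c ≠ s j)
    (hmin : ∀ k, occ s (s j) ≤ occ s k) (k : Fin n) (hk : k ≠ s j) :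
    occ (Function.update s j c) (s j) < occ (Function.update s j c) k := by
  have h1 := occ_update s j c k
  have h2 := occ_update s j c (s j)
  have h3 := hmin k
  rw [if_neg hk] at h1
  rw [if_pos rfl, if_neg hc.symm] at h2
  omega

open Classical in
/-- Switching: moving a ball out of a least loaded bin makes this bin the unique least
loaded one. -/
theorem card_not_uniqueMin_mul_le {n b : ℕ} (hn : 0 < n) {r : ℝ} :
    ((Finset.univ.filter fun s : Fin b → Fin n =>
        ¬ UniqueMin s ∧ ∀ i, r ≤ occ s i).card : ℝ) * (2 * r * (n - 1))
      ≤ ((Finset.univ.filter fun s : Fin b → Fin n => UniqueMin s).card : ℝ) * b := by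
  set T := Finset.univ.filter fun s : Fin b → Fin n => ¬ UniqueMin s ∧ ∀ i, r ≤ occ s i
  set U := Finset.univ.filter fun s : Fin b → Fin n => UniqueMin s
  let J : (Fin b → Fin n) → Finset (Fin b) := fun s =>
    Finset.univ.filter fun j => ∀ k, occ s (s j) ≤ occ s k
  -- Switches: a ball `j` in a least loaded bin of `s`, and a different bin for it. Double counting
  -- compares them with pairs (result, `j`).
  let D : Finset ((_ : Fin b → Fin n) × (_ : Fin b) × Fin n) :=
    T.sigma fun s => (J s).sigma fun j => Finset.univ.erase (s j)
  have hD : D.card ≤ (U ×ˢ (Finset.univ : Finset (Fin b))).card := by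
    refine Finset.card_le_card_of_injOn
      (fun x => (Function.update x.1 x.2.1 x.2.2, x.2.1)) ?_ ?_
    · rintro ⟨s, j, c⟩ h
      simp only [D, J, Finset.mem_coe, Finset.mem_sigma, Finset.mem_filter,
        Finset.mem_univ, true_and, Finset.mem_erase, and_true] at h
      simp only [Finset.coe_product, Set.mem_prod, Finset.mem_coe, Finset.mem_univ, and_true, U,
        Finset.mem_filter, true_and]
      exact ⟨s j, occ_update_lt h.2.2 h.2.1⟩
    · rintro ⟨s, j, c⟩ h ⟨s', j', c'⟩ h' he
      simp only [D, J, Finset.mem_coe, Finset.mem_sigma, Finset.mem_filter,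
        Finset.mem_univ, true_and, Finset.mem_erase, and_true] at h h'
      simp only [Prod.mk.injEq] at he
      obtain ⟨hu, rfl⟩ := he
      have hc : c = c' := by simpa using congrFun hu j
      subst hc
      -- The result remembers the origin of the ball: it is the unique least loaded bin.
      have hj : s j = s' j := by
        by_contra hne
        have h1 := occ_update_lt h.2.2 h.2.1 _ (Ne.symm hne)
        have h2 := occ_update_lt h'.2.2 h'.2.1 _ hne
        rw [hu] at h1
        omega
      have hss : s = s' := by
        funext x
        by_cases hx : x = j
        · rw [hx, hj]
        · simpa [hx] using congrFun hu x
      rw [hss]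
  -- Without a unique minimum, two bins attain it, each with at least `r` balls.
  have hJ : ∀ s ∈ T, 2 * r ≤ (J s).card := by
    intro s hs
    obtain ⟨hU, hr⟩ := (Finset.mem_filter.mp hs).2
    obtain ⟨i, -, hi⟩ := Finset.exists_min_image Finset.univ (occ s) ⟨⟨0, hn⟩, Finset.mem_univ _⟩
    simp only [UniqueMin, not_exists, not_forall, not_lt] at hU
    obtain ⟨k, hki, hk⟩ := hU i
    have hsub : (Finset.univ.filter fun j => s j = i) ∪ (Finset.univ.filter fun j => s j = k)
        ⊆ J s := by
      intro j hj
      simp only [Finset.mem_union, Finset.mem_filter, Finset.mem_univ, true_and] at hj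
      simp only [J, Finset.mem_filter, Finset.mem_univ, true_and]
      intro l
      have hl := hi l (Finset.mem_univ l)
      rcases hj with rfl | rfl <;> omega
    have hcard := Finset.card_le_card hsub
    rw [Finset.card_union_of_disjoint (Finset.disjoint_filter.mpr fun j _ h1 h2 =>
      hki (h2.symm.trans h1))] at hcard
    have h1 : (occ s i : ℝ) + occ s k ≤ (J s).card := by exact_mod_cast hcard
    linarith [hr i, hr k]
  have hDc : (D.card : ℝ) = ∑ s ∈ T, ((J s).card : ℝ) * (n - 1) := by
    rw [Finset.card_sigma]
    push_cast
    refine Finset.sum_congr rfl fun s _ => ?_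
    rw [Finset.card_sigma]
    simp [Nat.cast_sub (Nat.succ_le_of_lt hn)]
  have hn1 : (0 : ℝ) ≤ n - 1 := by
    have : (1 : ℝ) ≤ n := by exact_mod_cast hn
    linarith
  calc (T.card : ℝ) * (2 * r * (n - 1)) = ∑ s ∈ T, 2 * r * (n - 1) := by simp
    _ ≤ ∑ s ∈ T, ((J s).card : ℝ) * (n - 1) :=
        Finset.sum_le_sum fun s hs => mul_le_mul_of_nonneg_right (hJ s hs) hn1
    _ = D.card := hDc.symm
    _ ≤ (U ×ˢ (Finset.univ : Finset (Fin b))).card := by exact_mod_cast hD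
    _ = _ := by simp [Finset.card_product]

/-! ### Sampling laws and the two-batch process -/

theorem iidSamples_apply_toReal {n b : ℕ} (q : PMF (Fin n)) (s : Fin b → Fin n) :
    (iidSamples b q s).toReal = ∏ j, (q (s j)).toReal := by
  rw [← ENNReal.toReal_prod]; rfl

theorem sum_toReal_eq_one {n : ℕ} (q : PMF (Fin n)) : ∑ i, (q i).toReal = 1 := by
  rw [← ENNReal.toReal_sum fun i _ => q.apply_ne_top i, ← tsum_fintype (L := .unconditional _),
    q.tsum_coe, ENNReal.toReal_one]

theorem half_le_toOuterMeasure_occ {n b : ℕ} (q : PMF (Fin n)) (i : Fin n) {μ δ : ℝ}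
    (hδ₀ : 0 ≤ δ) (hδ₁ : δ ≤ 1) (hμ : μ ≤ b * (q i).toReal) (h : Real.log 2 ≤ δ ^ 2 * μ / 4) :
    ENNReal.ofReal (1 / 2) ≤
      (iidSamples b q).toOuterMeasure {s | (1 - δ) * μ < occ s i} := by
  classical
  have hset : {s : Fin b → Fin n | (1 - δ) * μ < occ s i}
      = ↑(Finset.univ.filter fun s : Fin b → Fin n => ¬ (occ s i : ℝ) ≤ (1 - δ) * μ) := by
    ext s; simp
  rw [hset, PMF.toOuterMeasure_apply_finset]
  refine ENNReal.ofReal_le_of_le_toReal ?_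
  rw [ENNReal.toReal_sum fun s _ => PMF.apply_ne_top _ s]
  have htail := sum_prod_le_exp (b := b) (fun k => (q k).toReal) (fun _ => ENNReal.toReal_nonneg)
    (sum_toReal_eq_one q) i hδ₀ hδ₁ hμ
  have hexp : Real.exp (-(δ ^ 2 * μ / 4)) ≤ 1 / 2 := by
    calc Real.exp (-(δ ^ 2 * μ / 4)) ≤ Real.exp (-Real.log 2) :=
          Real.exp_le_exp.mpr (neg_le_neg h)
      _ = 1 / 2 := by rw [Real.exp_neg, Real.exp_log two_pos, one_div]
  have htot : ∑ s : Fin b → Fin n, ∏ j, (q (s j)).toReal = 1 := by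
    rw [← Fintype.sum_pow (fun k => (q k).toReal), sum_toReal_eq_one, one_pow]
  rw [← Finset.sum_filter_add_sum_filter_not _
    (fun s : Fin b → Fin n => (occ s i : ℝ) ≤ (1 - δ) * μ)] at htot
  simp only [iidSamples_apply_toReal]
  linarith

theorem le_gap_batchUpdate {n b : ℕ} (y : Fin n → ℝ) (s : Fin b → Fin n) (i : Fin n) :
    y i + occ s i - (b : ℝ) / n ≤ gap (batchUpdate y s) := by
  unfold batchUpdate sortDesc
  set z : Fin n → ℝ :=
    fun i => y i + ((Finset.univ.filter (fun j => s j = i)).card : ℝ) - (b : ℝ) / n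
  set σ := Tuple.sort fun i => -z i
  have h := le_ciSup (Set.finite_range (z ∘ σ)).bddAbove (σ.symm i)
  rw [Function.comp_apply, Equiv.apply_symm_apply] at h
  exact h

theorem lt_sortDesc_of_unique_min {n : ℕ} {z : Fin n → ℝ} {i l : Fin n}
    (hi : ∀ k, k ≠ i → z i < z k) (hl : ∀ k, k ≤ l) (k : Fin n) (hk : k ≠ l) :
    sortDesc z l < sortDesc z k := by
  have h (j : Fin n) : sortDesc z l ≤ z j := by
    have := sortDesc_antitone z (hl ((Tuple.sort fun i => -z i).symm j))
    simpa [sortDesc] using this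
  have hli : Tuple.sort (fun i => -z i) l = i := by
    by_contra hne
    exact absurd (hi _ hne) (not_lt.mpr (h i))
  have hki : Tuple.sort (fun i => -z i) k ≠ i := fun hc =>
    hk ((Tuple.sort fun i => -z i).injective (hc.trans hli.symm))
  simpa [sortDesc, hli] using hi _ hki

theorem tieBreak_apply_of_unique {n : ℕ} (p : PMF (Fin n)) {y : Fin n → ℝ} {l : Fin n}
    (h : ∀ k, k ≠ l → y k ≠ y l) : tieBreak p y l = p l := by
  have ht : tieClass y l = {l} := by
    ext k
    simp only [tieClass, Finset.mem_filter, Finset.mem_univ, true_and, Finset.mem_singleton]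
    exact ⟨fun hk => by_contra fun hne => h k hne hk, fun hk => by rw [hk]⟩
  simp [tieBreak, ht]

theorem tieBreak_zero_apply {n : ℕ} (p : PMF (Fin n)) (i : Fin n) :
    tieBreak p 0 i = (n : ℝ≥0∞)⁻¹ := by
  have hp : ∑ i, p i = 1 := by simpa [tsum_fintype] using p.tsum_coe
  simp [tieBreak, tieClass, hp]

theorem batchUpdate_zero {n b : ℕ} (s : Fin b → Fin n) :
    batchUpdate 0 s = sortDesc fun i => (occ s i : ℝ) - (b : ℝ) / n := by
  simp [batchUpdate, occ]

theorem toOuterMeasure_loadLaw_two {n : ℕ} (b : ℕ) (p : PMF (Fin n)) (A : Set (Fin n → ℝ)) :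
    (loadLaw b p 2).toOuterMeasure A = ∑ s : Fin b → Fin n, iidSamples b (tieBreak p 0) s *
      (iidSamples b (tieBreak p (batchUpdate 0 s))).toOuterMeasure
        {s' | batchUpdate (batchUpdate 0 s) s' ∈ A} := by
  simp only [loadLaw, PMF.pure_bind, PMF.bind_map, PMF.toOuterMeasure_bind_apply, tsum_fintype,
    Function.comp_apply, PMF.toOuterMeasure_map_apply]
  rfl

/-! ### The first batch -/

open Classical in
/-- For large batches, uniform allocations have a unique least loaded bin, with a load that is
not far below the average, with probability at least `1 / 4`. -/
theorem card_uniqueMin_ge {n b : ℕ} (hn : 2 ≤ n) {δ : ℝ} (hδ₀ : 0 < δ) (hδ₁ : δ ≤ 1 / 8)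
    (hb : 6 * Real.log n ≤ δ ^ 2 * (b / n : ℝ) / 4) :
    (n : ℝ) ^ b / 4 ≤ ((Finset.univ.filter fun s : Fin b → Fin n =>
      UniqueMin s ∧ ∀ i, (1 - δ) * (b / n : ℝ) < occ s i).card : ℝ) := by
  have hn0 : 0 < n := by omega
  have hn2 : (2 : ℝ) ≤ n := by exact_mod_cast hn
  have hnpos : (0 : ℝ) < n := by linarith
  set m : ℝ := b / n with hm
  have hbm : (b : ℝ) = m * n := by rw [hm]; field_simp
  have hm0 : 0 < m := by
    have h1 : 0 < Real.log n := Real.log_pos (by linarith)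
    by_contra hneg
    nlinarith [mul_nonneg (sq_nonneg δ) (neg_nonneg.mpr (not_lt.mp hneg))]
  have hN : (0 : ℝ) < (n : ℝ) ^ b := by positivity
  set G := Finset.univ.filter fun s : Fin b → Fin n =>
    UniqueMin s ∧ ∀ i, (1 - δ) * m < occ s i
  set U := Finset.univ.filter fun s : Fin b → Fin n => UniqueMin s with hU
  set T := Finset.univ.filter fun s : Fin b → Fin n =>
    ¬ UniqueMin s ∧ ∀ i, (1 - δ) * m ≤ occ s i with hT
  let L : Fin n → Finset (Fin b → Fin n) := fun i =>
    Finset.univ.filter fun s => (occ s i : ℝ) ≤ (1 - δ) * m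
  set B := Finset.univ.biUnion L with hB
  have hL (i : Fin n) : ((L i).card : ℝ) ≤ (n : ℝ) ^ b * ((n : ℝ) ^ 6)⁻¹ := by
    have h := sum_prod_le_exp (b := b) (fun _ : Fin n => (n : ℝ)⁻¹) (fun _ => by positivity)
      (by simp [hnpos.ne']) i (μ := m) hδ₀.le (by linarith) (by rw [hm]; rfl)
    have he : Real.exp (-(δ ^ 2 * m / 4)) ≤ ((n : ℝ) ^ 6)⁻¹ := by
      calc Real.exp (-(δ ^ 2 * m / 4)) ≤ Real.exp (-((6 : ℕ) * Real.log n)) :=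
            Real.exp_le_exp.mpr (neg_le_neg (by exact_mod_cast hb))
        _ = ((n : ℝ) ^ 6)⁻¹ := by rw [Real.exp_neg, Real.exp_nat_mul, Real.exp_log hnpos]
    simp only [Finset.prod_const, Finset.card_univ, Fintype.card_fin, Finset.sum_const,
      nsmul_eq_mul, inv_pow] at h
    have h2 := h.trans he
    rw [← div_eq_mul_inv, div_le_iff₀ hN] at h2
    rw [mul_comm]
    exact h2
  -- Union bound: `n` bins at `n ^ (-6)` each, and `n ≥ 2`.
  have hBc : (B.card : ℝ) ≤ (n : ℝ) ^ b / 32 := by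
    calc (B.card : ℝ) ≤ ∑ i, ((L i).card : ℝ) := by exact_mod_cast Finset.card_biUnion_le
      _ ≤ ∑ _i : Fin n, (n : ℝ) ^ b * ((n : ℝ) ^ 6)⁻¹ := Finset.sum_le_sum fun i _ => hL i
      _ = (n : ℝ) ^ b / (n : ℝ) ^ 5 := by simp; field_simp
      _ ≤ (n : ℝ) ^ b / 32 := by
        have : (2 : ℝ) ^ 5 ≤ (n : ℝ) ^ 5 := by gcongr
        exact div_le_div_of_nonneg_left hN.le (by norm_num) (by linarith)
  have hB' {s : Fin b → Fin n} (h : s ∉ B) (i : Fin n) : (1 - δ) * m < occ s i := by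
    simp only [hB, L, Finset.mem_biUnion, Finset.mem_univ, true_and, Finset.mem_filter,
      not_exists, not_le] at h
    exact h i
  have hcover : (n : ℝ) ^ b ≤ U.card + T.card + B.card := by
    have hsub : (Finset.univ : Finset (Fin b → Fin n)) ⊆ U ∪ T ∪ B := by
      intro s _
      by_cases hs : s ∈ B
      · exact Finset.mem_union_right _ hs
      · refine Finset.mem_union_left _ ?_
        by_cases hu : UniqueMin s
        · exact Finset.mem_union_left _ (by simpa [hU] using hu)
        · exact Finset.mem_union_right _ (by simpa [hT] using ⟨hu, fun i => (hB' hs i).le⟩)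
    have h := (Finset.card_le_card hsub).trans (Finset.card_union_le _ _)
    have h' := h.trans (Nat.add_le_add_right (Finset.card_union_le _ _) _)
    simp only [Finset.card_univ, Fintype.card_fun, Fintype.card_fin] at h'
    exact_mod_cast h'
  have hUG : (U.card : ℝ) ≤ G.card + B.card := by
    have hsub : U ⊆ G ∪ B := by
      intro s hs
      by_cases hsB : s ∈ B
      · exact Finset.mem_union_right _ hsB
      · exact Finset.mem_union_left _ (Finset.mem_filter.mpr
          ⟨Finset.mem_univ _, (Finset.mem_filter.mp hs).2, hB' hsB⟩)
    exact_mod_cast (Finset.card_le_card hsub).trans (Finset.card_union_le _ _)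
  have hTU : (T.card : ℝ) ≤ 2 * U.card := by
    have h := card_not_uniqueMin_mul_le (b := b) hn0 (r := (1 - δ) * m)
    change (T.card : ℝ) * _ ≤ (U.card : ℝ) * b at h
    have h1 : (b : ℝ) / 2 ≤ 2 * ((1 - δ) * m) * (n - 1) := by
      have h2 : 7 / 8 * m ≤ (1 - δ) * m := mul_le_mul_of_nonneg_right (by linarith) hm0.le
      have h3 := mul_le_mul_of_nonneg_right h2 (by linarith : (0 : ℝ) ≤ n - 1)
      nlinarith
    have h4 := mul_le_mul_of_nonneg_left h1 (Nat.cast_nonneg (α := ℝ) T.card)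
    have hb0 : (0 : ℝ) < b := by rw [hbm]; positivity
    refine le_of_mul_le_mul_right ?_ hb0
    linarith
  -- `U ≥ (1 - 1/32) / 3` and `G ≥ U - 1/32 = 7/24 ≥ 1/4`, in units of `n ^ b`.
  linarith

end BatchedBins

/-! ### The second batch and the conclusion -/

theorem mainTheorem9 (C : ℝ) (hC₁ : 1 < C) (hC₂ : C ≤ 3 / 2) :
    ∃ κ : ℝ, 0 < κ ∧
      ∀ (n b : ℕ) (hn : 0 < n) (p : PMF (Fin n)),
        C / n ≤ (p ⟨n - 1, Nat.sub_lt hn Nat.one_pos⟩).toReal →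
        384 / (C - 1) ^ 2 * (n * Real.log n) ≤ (b : ℝ) →
        κ ≤ (BatchedBins.loadLaw b p 2).toMeasure.real
          {y : Fin n → ℝ | (C - 1) / 8 * ((b : ℝ) / n) ≤ BatchedBins.gap y} := by
  classical
  refine ⟨1 / 8, by norm_num, fun n b hn p hp hb => ?_⟩
  set l : Fin n := ⟨n - 1, Nat.sub_lt hn Nat.one_pos⟩
  have hl : ∀ k : Fin n, k ≤ l := fun k => Fin.le_def.mpr (Nat.le_sub_one_of_lt k.2)
  have hn2 : 2 ≤ n := by
    by_contra h
    obtain rfl : n = 1 := by omega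
    have h1 : (p l).toReal ≤ 1 := ENNReal.toReal_le_of_le_ofReal one_pos.le
      (by simpa using p.coe_le_one l)
    simp only [Nat.cast_one, div_one] at hp
    linarith
  have hn2' : (2 : ℝ) ≤ n := by exact_mod_cast hn2
  have hnpos : (0 : ℝ) < n := by linarith
  have hlog : Real.log 2 ≤ Real.log n := Real.log_le_log two_pos hn2'
  have hlog2 : 0 < Real.log 2 := Real.log_pos one_lt_two
  set m : ℝ := b / n with hm
  set δ : ℝ := (C - 1) / 4 with hδ
  have hδ₀ : 0 < δ := by rw [hδ]; linarith
  have hm0 : 0 ≤ m := by positivity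
  -- `δ ^ 2 / 4 = (C - 1) ^ 2 / 64`, and `384 = 6 * 64`.
  have hb' : 6 * Real.log n ≤ δ ^ 2 * m / 4 := by
    have h1 : 384 / (C - 1) ^ 2 * Real.log n ≤ m := by
      rw [hm, le_div_iff₀ hnpos]; linarith
    have hc : 0 < (C - 1) ^ 2 := by have : 0 < C - 1 := by linarith
                                    positivity
    have h2 := mul_le_mul_of_nonneg_left h1 hc.le
    rw [← mul_assoc, mul_div_cancel₀ _ hc.ne'] at h2
    rw [hδ, div_pow]
    linarith
  have hcard := BatchedBins.card_uniqueMin_ge (b := b) hn2 hδ₀ (by rw [hδ]; linarith) hb'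
  set G := Finset.univ.filter fun s : Fin b → Fin n =>
    BatchedBins.UniqueMin s ∧ ∀ i, (1 - δ) * (b / n : ℝ) < BatchedBins.occ s i
  set A := {y : Fin n → ℝ | (C - 1) / 8 * m ≤ BatchedBins.gap y}
  have hstep : ∀ s ∈ G, ENNReal.ofReal (1 / 2) ≤
      (BatchedBins.iidSamples b (BatchedBins.tieBreak p
        (BatchedBins.batchUpdate 0 s))).toOuterMeasure
        {s' | BatchedBins.batchUpdate (BatchedBins.batchUpdate 0 s) s' ∈ A} := by
    intro s hs
    obtain ⟨⟨i, hi⟩, hr⟩ := (Finset.mem_filter.mp hs).2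
    have hy : -(δ * m) ≤ BatchedBins.batchUpdate 0 s l := by
      rw [BatchedBins.batchUpdate_zero, BatchedBins.sortDesc, Function.comp_apply]
      have := hr (Tuple.sort (fun i => -((BatchedBins.occ s i : ℝ) - (b : ℝ) / n)) l)
      linarith
    have htb : BatchedBins.tieBreak p (BatchedBins.batchUpdate 0 s) l = p l := by
      refine BatchedBins.tieBreak_apply_of_unique p fun k hk => ?_
      rw [BatchedBins.batchUpdate_zero]
      exact (BatchedBins.lt_sortDesc_of_unique_min (i := i) (fun k hk =>
        sub_lt_sub_right (Nat.cast_lt.mpr (hi k hk)) _) hl k hk).ne'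
    have hCm : m ≤ C * m := le_mul_of_one_le_left hm0 hC₁.le
    have h := BatchedBins.half_le_toOuterMeasure_occ (b := b)
      (BatchedBins.tieBreak p (BatchedBins.batchUpdate 0 s)) l (μ := C * m) (δ := δ) hδ₀.le
      (by rw [hδ]; linarith)
      (by
        rw [htb]
        calc C * m = b * (C / n) := by rw [hm]; ring
          _ ≤ _ := mul_le_mul_of_nonneg_left hp b.cast_nonneg)
      (by nlinarith [mul_le_mul_of_nonneg_left hCm (sq_nonneg δ)])
    refine h.trans (MeasureTheory.measure_mono fun s' hs' => ?_)
    have hs'' : (1 - δ) * (C * m) < BatchedBins.occ s' l := hs'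
    refine le_trans ?_ (BatchedBins.le_gap_batchUpdate (BatchedBins.batchUpdate 0 s) s' l)
    -- The right side equals `(C - 1) * (3 - C) / 4`.
    have hcoef : (C - 1) / 8 ≤ -δ + (1 - δ) * C - 1 := by rw [hδ]; nlinarith
    have := mul_le_mul_of_nonneg_right hcoef hm0
    linarith
  have hw (s : Fin b → Fin n) : (BatchedBins.iidSamples b (BatchedBins.tieBreak p 0) s)
      = ENNReal.ofReal (((n : ℝ) ^ b)⁻¹) := by
    rw [← ENNReal.ofReal_toReal (PMF.apply_ne_top _ s), BatchedBins.iidSamples_apply_toReal]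
    simp [BatchedBins.tieBreak_zero_apply]
  have hmain : ENNReal.ofReal (1 / 8) ≤ (BatchedBins.loadLaw b p 2).toOuterMeasure A := by
    rw [BatchedBins.toOuterMeasure_loadLaw_two]
    calc ENNReal.ofReal (1 / 8)
        ≤ ENNReal.ofReal (G.card * (((n : ℝ) ^ b)⁻¹ * (1 / 2))) := by
          refine ENNReal.ofReal_le_ofReal ?_
          have hN : (0 : ℝ) < (n : ℝ) ^ b := by positivity
          have h := mul_le_mul_of_nonneg_right hcard (inv_nonneg.mpr hN.le)
          rw [div_mul_eq_mul_div, mul_inv_cancel₀ hN.ne'] at h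
          linarith
      _ = ∑ s ∈ G, ENNReal.ofReal (((n : ℝ) ^ b)⁻¹) * ENNReal.ofReal (1 / 2) := by
          rw [Finset.sum_const, nsmul_eq_mul, ENNReal.ofReal_mul (by positivity),
            ENNReal.ofReal_mul (by positivity), ENNReal.ofReal_natCast]
      _ ≤ ∑ s ∈ G, _ := Finset.sum_le_sum fun s hs => by
          rw [← hw s]
          exact mul_le_mul_right (hstep s hs) _
      _ ≤ _ := Finset.sum_le_sum_of_subset (Finset.subset_univ G)
  -- This inequality holds for every set, so measurability of `A` is not needed.
  have hfin := hmain.trans (PMF.toOuterMeasure_apply_le_toMeasure_apply _ A)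
  exact (ENNReal.ofReal_le_iff_le_toReal (MeasureTheory.measure_ne_top _ _)).mp hfin
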